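/- Let $(\mathcal S,\mathcal A,P,c,\gamma)$ be a finite Markov decision process with transition kernel $P(\cdot\mid s,a)$ on $\mathcal S$, stage cost $c:\mathcal S\times\mathcal A\to\mathbb R$ and discount factor $\gamma\in(0,1)$. For a policy $\pi:\mathcal S\to\mathcal A$ let $v^\pi(s)=\mathbb E\big[\sum_{t\ge0}\gamma^t c(s_t,\pi(s_t))\mid s_0=s\big]$, where $s_{t+1}\sim P(\cdot\mid s_t,\pi(s_t))$, and $q^\pi(s,a)=c(s,a)+\gamma\sum_{s'}P(s'\mid s,a)v^\pi(s')$. A policy $\pi^\star$ is optimal if $v^{\pi^\star}\le v^{\pi}$ for every $\pi$, and the optimal Q-function is $q^\star=q^{\pi^\star}$. Put $$[\overline{\mathbf T}(q)](s,a)=c(s,a)+\gamma\sum_{s'}P(s'\mid s,a)\min_{a'}q(s',a').$$ In every iteration $k=0,1,\dots$ a next state $\hat s_k(s,a)\sim P(\cdot\mid s,a)$ is sampled for every pair $(s,a)$, the samples of different iterations being independent. Let $[\widehat{\mathbf T}_k(q)](s,a)=c(s,a)+\gamma\min_{a'}q(\hat s_k(s,a),a')$ and $\lambda_k=1/(k+1)$.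 Q-learning (QL), started at $q_0$, is $q^{\rm QL}_0=q_0$, $q^{\rm QL}_{k+1}=(1-\lambda_k)q^{\rm QL}_k+\lambda_k\widehat{\mathbf T}_k(q^{\rm QL}_k)$. Rank-one Q-learning (R1-QL), started at $q_0\in\mathbb R^{\mathcal S\times\mathcal A}$ and a probability vector $d_{-1}$ on $\mathcal S\times\mathcal A$, chooses for each $(s,a)$ any $\hat a_k(s,a)\in\arg\min_{a'}q_k(\hat s_k(s,a),a')$ and sets $$f_k(y)=\sum_{(s,a):\,(\hat s_k(s,a),\hat a_k(s,a))=y}d_{k-1}(s,a),\qquad \tilde d_k=(1-\lambda_k)d_{k-1}+\lambda_k f_k,\qquad d_k=\tilde d_k/\|\tilde d_k\|_1,$$ $$q_{k+1}=(1-\lambda_k)q_k+\lambda_k\widehat{\mathbf T}_k(q_k)+\frac{\gamma\lambda_k}{1-\gamma}\big\langle d_k,\widehat{\mathbf T}_k(q_k)-q_k\big\rangle\mathbf 1 .$$ Then the optimal Q-function $q^\star$ exists, $q^\star=\overline{\mathbf T}(q^\star)$, and R1-QL converges to it almost surely with at least the same rate as QL: (i) For all $q_0$ and $d_{-1}$,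 almost surely $q_k\to q^\star$; moreover, almost surely, for every positive sequence $(\rho_k)$ with $\sum_{l<k}\rho_l=O(k\rho_k)$ (for instance $\rho_k=(k+1)^{-r}$ with $r<1$), if the QL iterates started at the same $q_0$ and driven by the same samples satisfy $\|q^{\rm QL}_k-q^\star\|_\infty=O(\rho_k)$, then $\|q_k-q^\star\|_\infty=O(\rho_k)$. (ii) For all real $r,s$: if for every $q_0$ the QL iterates started at $q_0$ satisfy $\|q^{\rm QL}_k-q^\star\|_\infty=O(k^{-r}(\log k)^s)$ almost surely, then for all $q_0$ and $d_{-1}$ the R1-QL iterates satisfy $\|q_k-q^\star\|_\infty=O(k^{-r}(\log k)^s)$ almost surely. -/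

import Mathlib

open MeasureTheory ProbabilityTheory Filter Topology Asymptotics

noncomputable section

/-- A finite discounted Markov decision process with states `S`, actions `A`, transition kernel `P`,
stage cost `c` and discount factor `γ ∈ (0,1)`. -/
structure MDP (S A : Type*) where
  P : S → A → PMF S
  c : S × A → ℝ
  γ : ℝ
  γ_pos : 0 < γ
  γ_lt_one : γ < 1

namespace MDP

variable {S A : Type*}

section Optimality

variable [Fintype S] [MeasurableSpace S] [MeasurableSingletonClass S]

/-- The next-state kernel under the policy `π`, as a function of the state history up to time `t`. -/
def stepKernel (M : MDP S A) (π : S → A) (t : ℕ) :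
    Kernel ((i : Finset.Iic t) → (fun _ : ℕ => S) i) S :=
  (Kernel.ofFunOfCountable fun s : S => (M.P s (π s)).toMeasure).comap
    (fun h => h ⟨t, Finset.mem_Iic.2 le_rfl⟩) (measurable_pi_apply _)

instance (M : MDP S A) (π : S → A) (t : ℕ) : IsMarkovKernel (M.stepKernel π t) := by
  constructor
  intro h
  rw [stepKernel, Kernel.comap_apply]
  exact PMF.toMeasure.isProbabilityMeasure _

/-- The law of the state trajectory `(s₀, s₁, …)` of the Markov chain under `π` with `s₀ = s`. -/
def trajLaw (M : MDP S A) (π : S → A) (s : S) : Measure (ℕ → S) :=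
  Kernel.trajMeasure (X := fun _ => S) (Measure.dirac s) (M.stepKernel π)

/-- The value function of `π`: the expected discounted cost over an infinite trajectory. -/
def value (M : MDP S A) (π : S → A) (s : S) : ℝ :=
  ∫ w, ∑' t : ℕ, M.γ ^ t * M.c (w t, π (w t)) ∂(M.trajLaw π s)

/-- The action-value function (Q-function) of `π`. -/
def qValue (M : MDP S A) (π : S → A) : S × A → ℝ :=
  fun z => M.c z + M.γ * ∑ s', (M.P z.1 z.2 s').toReal * M.value π s'

/-- `π` is an optimal policy. -/
def IsOptimalPolicy (M : MDP S A) (π : S → A) : Prop :=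
  ∀ π' : S → A, ∀ s, M.value π s ≤ M.value π' s

/-- `q` is the optimal Q-function, i.e. the Q-function of an optimal policy. -/
def IsOptimalQ (M : MDP S A) (q : S × A → ℝ) : Prop :=
  ∃ π : S → A, M.IsOptimalPolicy π ∧ q = M.qValue π

end Optimality

section Algorithms

variable [Fintype A] [Nonempty A]

/-- `min_{a} q(s, a)`. -/
def minQ (q : S × A → ℝ) (s : S) : ℝ :=
  Finset.univ.inf' Finset.univ_nonempty fun a => q (s, a)

/-- The Bellman optimality operator for Q-functions. -/
def bellmanQ [Fintype S] (M : MDP S A) (q : S × A → ℝ) : S × A → ℝ :=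
  fun z => M.c z + M.γ * ∑ s', (M.P z.1 z.2 s').toReal * minQ q s'

/-- The empirical Bellman operator; `x z` is the sampled next state for the state-action pair `z`. -/
def empBellmanQ (M : MDP S A) (x : S × A → S) (q : S × A → ℝ) : S × A → ℝ :=
  fun z => M.c z + M.γ * minQ q (x z)

/-- The step sizes `λ_k = 1/(k+1)`. -/
def stepSize (k : ℕ) : ℝ := 1 / ((k : ℝ) + 1)

/-- The iterates of synchronous Q-learning driven by the samples `x k z`, started at `q₀`. -/
def qlIter (M : MDP S A) (x : ℕ → S × A → S) (q₀ : S × A → ℝ) : ℕ → S × A → ℝ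
  | 0 => q₀
  | k + 1 => fun z =>
      qlIter M x q₀ k z -
        stepSize k * (qlIter M x q₀ k z - M.empBellmanQ (x k) (qlIter M x q₀ k) z)

variable [Fintype S]

open Classical in
/-- The vector `f` accumulated in one iteration: the mass `d z` of each pair `z` is added to the
entry `(x z, a z)`. -/
def pushMass (x : S × A → S) (a : S × A → A) (d : S × A → ℝ) : S × A → ℝ :=
  fun y => ∑ z, if (x z, a z) = y then d z else 0

/-- Normalization of a vector by its 1-norm. -/
def normalizeL1 (d : S × A → ℝ) : S × A → ℝ := fun y => d y / ∑ z, |d z|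

/-- `(q, d, a)` is a run of synchronous rank-one Q-learning driven by the samples `x k z`, with
initialization `q₀`, `d₀`. The index of `d` is shifted by one: `d 0` is the initial vector and
`d (k+1)` is the estimate formed in iteration `k`. The action `a k z` is an arbitrary minimizer of
`q k (x k z, ·)`, so every rule for breaking ties is covered. -/
structure IsR1QLRun (M : MDP S A) (x : ℕ → S × A → S) (q₀ d₀ : S × A → ℝ)
    (q d : ℕ → S × A → ℝ) (a : ℕ → S × A → A) : Prop where
  q_zero : q 0 = q₀
  d_zero : d 0 = d₀
  greedy : ∀ k z b, q k (x k z, a k z) ≤ q k (x k z, b)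
  d_succ : ∀ k, d (k + 1) =
    normalizeL1 ((1 - stepSize k) • d k + stepSize k • pushMass (x k) (a k) (d k))
  q_succ : ∀ k z, q (k + 1) z =
    (1 - stepSize k) * q k z + stepSize k * M.empBellmanQ (x k) (q k) z +
      M.γ * stepSize k / (1 - M.γ) * ∑ y, d (k + 1) y * (M.empBellmanQ (x k) (q k) y - q k y)

end Algorithms

/-- Samples from the generative model: in every iteration `k` and for every pair `z`, the random
state `X k z` has law `P(· | z)`, and the samples of different iterations are independent (samples
within one iteration may have any joint law). -/
structure IsSampling (M : MDP S A) [MeasurableSpace S] {Ω : Type*} [MeasurableSpace Ω]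
    (μ : Measure Ω) (X : ℕ → S × A → Ω → S) : Prop where
  measurable : ∀ k z, Measurable (X k z)
  law : ∀ k z, μ.map (X k z) = (M.P z.1 z.2).toMeasure
  indep : iIndepFun (fun k ω z => X k z ω) μ

end MDP

end

/-!
With step sizes `1/(k+1)` the Q-learning iterate `Q_k` is the running average of the updates
`T̂_l Q_l`, `l < k`. Hence `ε_k = ‖Q_k - q*‖` satisfies `ε_k ≤ γ · avg_{l<k} ε_l + o(1)` as soon as
the averages of `T̂_l q*` converge to `T̄ q* = q*`, and then `ε_k → 0`.

As `T̂` maps `q + b𝟏` to `T̂ q + γb𝟏`, the rank-one iterate is `q_k = Q_k + e_k𝟏`; the factor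
`γ/(1-γ)` is the one which cancels the extra term `γ e_k` in the recursion for `e_k` and leaves the
running average of `γ/(1-γ) ⟨d_l, T̂_l Q_l - Q_l⟩`. The residuals `T̂_l Q_l - Q_l`, `l < k`, have
mean `Q_k - avg_{l<k} Q_l`, whose norm is at most `ε_k + avg_{l<k} ε_l`, and `d_l` changes by at
most `1/l` in a step, so summation by parts bounds `e_k` by iterated running averages of `ε`.
Running averages preserve convergence to zero and every rate `ρ` with `∑_{l<k} ρ_l = O(k ρ_k)`.

The rate `k^{-r} (log k)^s` is of this kind when `r < 1`, which is forced if it holds for all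
starting points: the Q-learning iterates started at `q₀ + 𝟏` and at `q₀` differ by
`∏_{l<k} (1 - (1-γ)/(l+1)) 𝟏`, which is of order `k^{-(1-γ)}`.
-/

section RunningAverage

variable {E : Type*} [NormedAddCommGroup E] [NormedSpace ℝ E]

/-- The running average `k⁻¹ (u 0 + ⋯ + u (k - 1))` of the first `k` terms of a sequence; it is `0`
for `k = 0`. -/
noncomputable def runningAvg (u : ℕ → E) (k : ℕ) : E :=
  (k : ℝ)⁻¹ • ∑ l ∈ Finset.range k, u l

@[simp]
lemma runningAvg_zero (u : ℕ → E) : runningAvg u 0 = 0 := by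
  simp [runningAvg]

lemma natCast_smul_runningAvg (u : ℕ → E) (k : ℕ) :
    (k : ℝ) • runningAvg u k = ∑ l ∈ Finset.range k, u l := by
  rcases eq_or_ne k 0 with rfl | hk
  · simp
  · rw [runningAvg, smul_inv_smul₀ (Nat.cast_ne_zero.2 hk)]

lemma runningAvg_succ (u : ℕ → E) (k : ℕ) :
    runningAvg u (k + 1) =
      (1 - MDP.stepSize k) • runningAvg u k + MDP.stepSize k • u k := by
  have hk : (k : ℝ) + 1 ≠ 0 := by positivity
  have hcoeff : 1 - MDP.stepSize k = ((k : ℝ) + 1)⁻¹ * k := by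
    rw [MDP.stepSize]
    field_simp
    ring
  rw [hcoeff, mul_smul, natCast_smul_runningAvg, runningAvg, Finset.sum_range_succ, smul_add,
    Nat.cast_succ, MDP.stepSize, one_div]

lemma runningAvg_sub (u v : ℕ → E) (k : ℕ) :
    runningAvg (fun l => u l - v l) k = runningAvg u k - runningAvg v k := by
  rw [runningAvg, Finset.sum_sub_distrib, smul_sub, runningAvg, runningAvg]

lemma runningAvg_const (p : E) {k : ℕ} (hk : 0 < k) : runningAvg (fun _ => p) k = p := by
  rw [runningAvg, Finset.sum_const, Finset.card_range, ← Nat.cast_smul_eq_nsmul ℝ,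
    inv_smul_smul₀ (Nat.cast_ne_zero.2 hk.ne')]

lemma runningAvg_const_mul (a : ℝ) (u : ℕ → ℝ) (k : ℕ) :
    runningAvg (fun l => a * u l) k = a * runningAvg u k := by
  rw [runningAvg, runningAvg, ← Finset.mul_sum, smul_eq_mul, smul_eq_mul, mul_left_comm]

lemma runningAvg_finsetSum {ι : Type*} (s : Finset ι) (u : ℕ → ι → E) (k : ℕ) :
    runningAvg (fun l => ∑ i ∈ s, u l i) k = ∑ i ∈ s, runningAvg (fun l => u l i) k := by
  simp only [runningAvg]
  rw [Finset.sum_comm, Finset.smul_sum]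

lemma runningAvg_apply {ι : Type*} [Fintype ι] (u : ℕ → ι → E) (k : ℕ) (i : ι) :
    runningAvg u k i = runningAvg (fun l => u l i) k := by
  simp [runningAvg]

lemma norm_runningAvg_le (u : ℕ → E) (k : ℕ) :
    ‖runningAvg u k‖ ≤ runningAvg (fun l => ‖u l‖) k := by
  rw [runningAvg, norm_smul, Real.norm_of_nonneg (by positivity)]
  exact mul_le_mul_of_nonneg_left (norm_sum_le _ _) (by positivity)

lemma runningAvg_le_runningAvg {u v : ℕ → ℝ} {k : ℕ} (h : ∀ l < k, u l ≤ v l) :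
    runningAvg u k ≤ runningAvg v k :=
  mul_le_mul_of_nonneg_left (Finset.sum_le_sum fun l hl => h l (Finset.mem_range.1 hl))
    (by positivity)

lemma runningAvg_nonneg {u : ℕ → ℝ} (h : ∀ l, 0 ≤ u l) (k : ℕ) : 0 ≤ runningAvg u k :=
  mul_nonneg (by positivity) (Finset.sum_nonneg fun l _ => h l)

lemma eventually_runningAvg_lt {u : ℕ → ℝ} {a b : ℝ} (hu : ∀ᶠ k in atTop, u k ≤ a) (hab : a < b) :
    ∀ᶠ k in atTop, runningAvg u k < b := by
  have hmax : Tendsto (fun k => max (u k) a) atTop (𝓝 a) :=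
    tendsto_const_nhds.congr' (hu.mono fun k hk => (max_eq_right hk).symm)
  filter_upwards [hmax.cesaro_smul.eventually_lt_const hab] with k hk
  exact (runningAvg_le_runningAvg fun l _ => le_max_left (u l) a).trans_lt hk

lemma bddAbove_of_le_mul_runningAvg_add {ε : ℕ → ℝ} {γ c : ℝ} (hγ₀ : 0 ≤ γ) (hγ₁ : γ < 1)
    (h : ∀ k, 0 < k → ε k ≤ γ * runningAvg ε k + c) : BddAbove (Set.range ε) := by
  set b := max (ε 0) (c / (1 - γ))
  have hc : c ≤ (1 - γ) * b := (div_le_iff₀' (sub_pos.2 hγ₁)).1 (le_max_right _ _)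
  suffices ∀ k, ε k ≤ b from ⟨b, Set.forall_mem_range.2 this⟩
  intro k
  induction k using Nat.strong_induction_on with
  | _ k ih =>
    rcases k.eq_zero_or_pos with rfl | hk
    · exact le_max_left _ _
    · have havg : runningAvg ε k ≤ b :=
        (runningAvg_le_runningAvg ih).trans_eq (runningAvg_const b hk)
      linarith [h k hk, mul_le_mul_of_nonneg_left havg hγ₀]

lemma tendsto_zero_of_le_mul_runningAvg_add {ε η : ℕ → ℝ} {γ : ℝ} (hγ₀ : 0 ≤ γ) (hγ₁ : γ < 1)
    (hε : ∀ k, 0 ≤ ε k) (hη : Tendsto η atTop (𝓝 0))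
    (h : ∀ k, 0 < k → ε k ≤ γ * runningAvg ε k + η k) : Tendsto ε atTop (𝓝 0) := by
  obtain ⟨c, hc⟩ := hη.bddAbove_range
  have hbdd : IsBoundedUnder (· ≤ ·) atTop ε :=
    (bddAbove_of_le_mul_runningAvg_add hγ₀ hγ₁ fun k hk =>
      (h k hk).trans (add_le_add_right (hc (Set.mem_range_self k)) _)).isBoundedUnder_of_range
  have hcobdd : IsBoundedUnder (· ≥ ·) atTop ε := isBoundedUnder_of ⟨0, hε⟩
  set L := limsup ε atTop
  have hL : ∀ δ > 0, L ≤ γ * (L + 2 * δ) + δ := fun δ hδ => by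
    have hlt : ∀ᶠ k in atTop, ε k < L + δ :=
      eventually_lt_of_limsup_lt (lt_add_of_pos_right L hδ) hbdd
    refine limsup_le_of_le hcobdd.isCoboundedUnder_le ?_
    filter_upwards [eventually_runningAvg_lt (hlt.mono fun k => le_of_lt)
      (show L + δ < L + 2 * δ by linarith), hη.eventually_lt_const hδ, eventually_gt_atTop 0]
      with k havg hηk hk
    linarith [h k hk, mul_le_mul_of_nonneg_left havg.le hγ₀]
  have hL₀ : L ≤ 0 := by
    by_contra! hpos
    have := hL ((1 - γ) * L / 4) (by have := sub_pos.2 hγ₁; positivity)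
    nlinarith [mul_pos (sub_pos.2 hγ₁) hpos, mul_nonneg hγ₀ hpos.le]
  exact tendsto_of_le_liminf_of_limsup_le
    (le_liminf_of_le hbdd.isCoboundedUnder_ge (Eventually.of_forall hε)) hL₀ hbdd hcobdd

/-- The sequence `u` increased by its running averages: the operation which summation by parts
against slowly varying weights performs on error bounds. -/
noncomputable def addRunningAvg (u : ℕ → ℝ) (k : ℕ) : ℝ :=
  u k + runningAvg u k

lemma addRunningAvg_le_addRunningAvg {u v : ℕ → ℝ} (h : ∀ l, u l ≤ v l) (k : ℕ) :
    addRunningAvg u k ≤ addRunningAvg v k :=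
  add_le_add (h k) (runningAvg_le_runningAvg fun l _ => h l)

lemma le_addRunningAvg {u : ℕ → ℝ} (h : ∀ l, 0 ≤ u l) (k : ℕ) : u k ≤ addRunningAvg u k :=
  le_add_of_nonneg_right (runningAvg_nonneg h k)

lemma addRunningAvg_nonneg {u : ℕ → ℝ} (h : ∀ l, 0 ≤ u l) (k : ℕ) : 0 ≤ addRunningAvg u k :=
  (h k).trans (le_addRunningAvg h k)

lemma tendsto_addRunningAvg {u : ℕ → ℝ} (hu : Tendsto u atTop (𝓝 0)) :
    Tendsto (addRunningAvg u) atTop (𝓝 0) := by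
  have h := hu.add hu.cesaro_smul
  rw [add_zero] at h
  exact h

lemma sum_range_norm_runningAvg_succ (n : ℕ → E) (k : ℕ) :
    ∑ l ∈ Finset.range k, ‖runningAvg n (l + 1)‖ =
      ∑ l ∈ Finset.range (k + 1), ‖runningAvg n l‖ := by
  rw [Finset.sum_range_succ', runningAvg_zero, norm_zero, add_zero]

lemma norm_runningAvg_smul_le {w : ℕ → ℝ} {b : ℝ} (hw : ∀ k, |w k| ≤ b)
    (hd : ∀ k : ℕ, |w (k + 1) - w k| ≤ b / ((k : ℝ) + 1)) (n : ℕ → E) (k : ℕ) :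
    ‖runningAvg (fun l => w l • n l) k‖ ≤ b * addRunningAvg (fun l => ‖runningAvg n l‖) k := by
  rcases k with - | k
  · simp [addRunningAvg]
  have hterm : ∀ l, ‖(w (l + 1) - w l) • ∑ i ∈ Finset.range (l + 1), n i‖ ≤
      b * ‖runningAvg n (l + 1)‖ := fun l => by
    have hl : (0 : ℝ) < (l : ℝ) + 1 := by positivity
    rw [← natCast_smul_runningAvg, smul_smul, norm_smul, norm_mul, Real.norm_natCast, Nat.cast_succ]
    exact mul_le_mul_of_nonneg_right ((le_div_iff₀ hl).1 (hd l)) (norm_nonneg _)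
  have hparts : ‖∑ l ∈ Finset.range (k + 1), w l • n l‖ ≤
      b * ‖((k + 1 : ℕ) : ℝ) • runningAvg n (k + 1)‖ +
        b * ∑ l ∈ Finset.range (k + 1), ‖runningAvg n l‖ := by
    rw [Finset.sum_range_by_parts, add_tsub_cancel_right, natCast_smul_runningAvg,
      ← sum_range_norm_runningAvg_succ, Finset.mul_sum]
    refine (norm_sub_le _ _).trans (add_le_add ?_ (norm_sum_le_of_le _ fun l _ => hterm l))
    rw [norm_smul]
    exact mul_le_mul_of_nonneg_right (hw k) (norm_nonneg _)
  have hk : (0 : ℝ) < ((k + 1 : ℕ) : ℝ) := by positivity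
  rw [norm_smul, Real.norm_natCast] at hparts
  rw [runningAvg, norm_smul, norm_inv, Real.norm_natCast, inv_mul_le_iff₀ hk, addRunningAvg]
  refine hparts.trans_eq ?_
  rw [← natCast_smul_runningAvg (fun l => ‖runningAvg n l‖), smul_eq_mul]
  ring

lemma abs_runningAvg_dotProduct_le {ι : Type*} [Fintype ι] {w : ℕ → ι → ℝ} {b : ℝ}
    (hw : ∀ k i, |w k i| ≤ b) (hd : ∀ (k : ℕ) i, |w (k + 1) i - w k i| ≤ b / ((k : ℝ) + 1))
    (n : ℕ → ι → ℝ) (k : ℕ) :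
    |runningAvg (fun l => w l ⬝ᵥ n l) k| ≤
      Fintype.card ι * b * addRunningAvg (fun l => ‖runningAvg n l‖) k := by
  have hcoord : ∀ i, |runningAvg (fun l => w l i * n l i) k| ≤
      b * addRunningAvg (fun l => ‖runningAvg n l‖) k := fun i =>
    (norm_runningAvg_smul_le (fun k => hw k i) (fun k => hd k i) (fun l => n l i) k).trans <|
      mul_le_mul_of_nonneg_left (addRunningAvg_le_addRunningAvg (fun l => by
        rw [← runningAvg_apply]; exact norm_le_pi_norm _ i) k) ((abs_nonneg _).trans (hw 0 i))
  calc |runningAvg (fun l => w l ⬝ᵥ n l) k|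
      ≤ ∑ i, |runningAvg (fun l => w l i * n l i) k| := by
        simp only [dotProduct, runningAvg_finsetSum]
        exact Finset.abs_sum_le_sum_abs _ _
    _ ≤ ∑ _i : ι, b * addRunningAvg (fun l => ‖runningAvg n l‖) k :=
        Finset.sum_le_sum fun i _ => hcoord i
    _ = _ := by rw [Finset.sum_const, Finset.card_univ, nsmul_eq_mul, mul_assoc]

end RunningAverage

section SumRate

lemma isBigO_sum_range_of_isBigO_sub {u v : ℕ → ℝ} (hpos : ∀ᶠ k in atTop, 0 < v k)
    (hmono : ∀ᶠ k in atTop, v k ≤ v (k + 1)) (hu : u =O[atTop] fun k => v (k + 1) - v k) :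
    (fun k => ∑ l ∈ Finset.range k, u l) =O[atTop] v := by
  obtain ⟨C, hC, hbound⟩ := hu.exists_pos
  obtain ⟨N, hN⟩ := eventually_atTop.1 (hpos.and (hmono.and hbound.bound))
  set m := ‖∑ l ∈ Finset.range N, u l‖
  have hv : 0 < v N := (hN N le_rfl).1
  have hsum : ∀ k ≥ N, v N ≤ v k ∧ ‖∑ l ∈ Finset.range k, u l‖ ≤ m + C * (v k - v N) := by
    intro k hk
    induction k, hk using Nat.le_induction with
    | base => simp [m]
    | succ k hk ih =>
      obtain ⟨-, hstep, huk⟩ := hN k hk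
      rw [Real.norm_of_nonneg (sub_nonneg.2 hstep)] at huk
      rw [Finset.sum_range_succ]
      exact ⟨ih.1.trans hstep, (norm_add_le_of_le ih.2 huk).trans_eq (by ring)⟩
  refine IsBigO.of_bound (m / v N + C) ?_
  filter_upwards [eventually_ge_atTop N] with k hk
  obtain ⟨hle, hbound⟩ := hsum k hk
  have hhead : m ≤ m / v N * v k := by
    rw [div_mul_eq_mul_div, le_div_iff₀ hv]
    exact mul_le_mul_of_nonneg_left hle (norm_nonneg _)
  rw [Real.norm_of_nonneg (hv.le.trans hle)]
  linarith [mul_pos hC hv]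

lemma isBigO_sum_range {u ρ : ℕ → ℝ} (hρ : 0 < ρ) (hu : u =O[atTop] ρ) :
    (fun k => ∑ l ∈ Finset.range k, u l) =O[atTop] fun k => ∑ l ∈ Finset.range k, ρ l := by
  obtain ⟨hρ₀, j, hj⟩ := Pi.lt_def.1 hρ
  refine isBigO_sum_range_of_isBigO_sub ?_ (Eventually.of_forall fun k => ?_) ?_
  · filter_upwards [eventually_gt_atTop j] with k hk
    exact Finset.sum_pos' (fun l _ => hρ₀ l) ⟨j, Finset.mem_range.2 hk, hj⟩
  · rw [Finset.sum_range_succ]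
    exact le_add_of_nonneg_right (hρ₀ k)
  · simpa only [Finset.sum_range_succ_sub_sum] using hu

lemma isBigO_addRunningAvg {u ρ : ℕ → ℝ} (hρ : 0 < ρ)
    (hsum : (fun k => ∑ l ∈ Finset.range k, ρ l) =O[atTop] fun k => (k : ℝ) * ρ k)
    (hu : u =O[atTop] ρ) : addRunningAvg u =O[atTop] ρ := by
  refine hu.add ?_
  refine (((isBigO_refl (fun k : ℕ => (k : ℝ)⁻¹) atTop).smul
    ((isBigO_sum_range hρ hu).trans hsum)).trans_eventuallyEq ?_)
  filter_upwards [eventually_ne_atTop 0] with k hk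
  rw [smul_eq_mul, inv_mul_cancel_left₀ (Nat.cast_ne_zero.2 hk)]

lemma div_succ_rpow_le {t : ℝ} (ht₀ : 0 ≤ t) (ht₁ : t ≤ 1) (k : ℕ) :
    ((k : ℝ) / (k + 1)) ^ t ≤ 1 - t / (k + 1) := by
  have hs : -1 ≤ -((k : ℝ) + 1)⁻¹ := neg_le_neg (inv_le_one_of_one_le₀ (by linarith))
  calc ((k : ℝ) / (k + 1)) ^ t = (1 + -((k : ℝ) + 1)⁻¹) ^ t := by
        congr 1
        field_simp
        ring
    _ ≤ 1 + t * -((k : ℝ) + 1)⁻¹ := rpow_one_add_le_one_add_mul_self hs ht₀ ht₁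
    _ = 1 - t / (k + 1) := by ring

lemma mul_rpow_div_succ_le_rpow_succ_sub_rpow {t : ℝ} (ht₀ : 0 ≤ t) (ht₁ : t ≤ 1) (k : ℕ) :
    t * ((k : ℝ) + 1) ^ t / (k + 1) ≤ ((k : ℝ) + 1) ^ t - (k : ℝ) ^ t := by
  have hk : (0 : ℝ) < (k : ℝ) + 1 := by positivity
  have hpow := div_succ_rpow_le ht₀ ht₁ k
  rw [Real.div_rpow k.cast_nonneg hk.le, div_le_iff₀ (Real.rpow_pos_of_pos hk t)] at hpow
  linarith [mul_div_right_comm t (((k : ℝ) + 1) ^ t) ((k : ℝ) + 1)]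

lemma isBigO_sum_range_of_monotoneOn {ρ : ℕ → ℝ} {t : ℝ} {N : ℕ} (ht₀ : 0 < t) (ht₁ : t ≤ 1)
    (hpos : ∀ᶠ k in atTop, 0 < ρ k)
    (hmono : MonotoneOn (fun k : ℕ => (k : ℝ) ^ (1 - t) * ρ k) (Set.Ici N)) :
    (fun k => ∑ l ∈ Finset.range k, ρ l) =O[atTop] fun k => (k : ℝ) * ρ k := by
  set v : ℕ → ℝ := fun k => (k : ℝ) ^ (1 - t) * ρ k
  have hv : ∀ k : ℕ, 0 < k → (k : ℝ) * ρ k = (k : ℝ) ^ t * v k := fun k hk => by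
    rw [← mul_assoc, ← Real.rpow_add (by positivity), add_sub_cancel, Real.rpow_one]
  have hincr : ∀ᶠ k in atTop,
      0 < ρ k ∧ t / 2 * ρ k ≤ ((k + 1 : ℕ) : ℝ) * ρ (k + 1) - (k : ℝ) * ρ k := by
    filter_upwards [hpos, eventually_ge_atTop N, eventually_gt_atTop 0] with k hρk hNk hk
    refine ⟨hρk, ?_⟩
    have hk₁ : (1 : ℝ) ≤ k := Nat.one_le_cast.2 hk
    have hvk : 0 ≤ v k := by positivity
    have hvmono : v k ≤ v (k + 1) := hmono hNk (Nat.le_succ_of_le hNk) k.le_succ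
    have hpow : t / 2 * ((k : ℝ) ^ t / k) ≤ ((k + 1 : ℕ) : ℝ) ^ t - (k : ℝ) ^ t := by
      push_cast
      refine le_trans ?_ (mul_rpow_div_succ_le_rpow_succ_sub_rpow ht₀.le ht₁ k)
      rw [div_mul_div_comm]
      gcongr <;> linarith
    calc t / 2 * ρ k = t / 2 * ((k : ℝ) ^ t / k) * v k := by
          rw [mul_assoc, div_mul_eq_mul_div ((k : ℝ) ^ t), ← hv k hk,
            mul_div_cancel_left₀ _ (by positivity)]
      _ ≤ (((k + 1 : ℕ) : ℝ) ^ t - (k : ℝ) ^ t) * v k := mul_le_mul_of_nonneg_right hpow hvk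
      _ ≤ ((k + 1 : ℕ) : ℝ) * ρ (k + 1) - (k : ℝ) * ρ k := by
          rw [hv k hk, hv (k + 1) k.succ_pos, sub_mul]
          gcongr
  refine isBigO_sum_range_of_isBigO_sub ?_ ?_ (IsBigO.of_bound (t / 2)⁻¹ ?_)
  · filter_upwards [hpos, eventually_gt_atTop 0] with k hρk hk
    positivity
  · filter_upwards [hincr] with k ⟨hρk, hk⟩
    linarith [mul_pos (half_pos ht₀) hρk]
  · filter_upwards [hincr] with k ⟨hρk, hk⟩
    rw [Real.norm_of_nonneg hρk.le, ← div_eq_inv_mul, le_div_iff₀' (half_pos ht₀)]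
    exact hk.trans (le_abs_self _)

lemma monotoneOn_rpow_mul_log_rpow {p : ℝ} (hp : 0 < p) (s : ℝ) :
    MonotoneOn (fun x : ℝ => x ^ p * Real.log x ^ s) (Set.Ici (Real.exp (|s| / p))) := by
  have hone : ∀ x ∈ Set.Ici (Real.exp (|s| / p)), 1 ≤ x := fun x hx =>
    (Real.one_le_exp (by positivity)).trans hx
  rcases le_or_gt 0 s with hs | hs
  · intro x hx y hy hxy
    have hx₁ := hone x hx
    have hy₁ := hone y hy
    have hlog := Real.log_nonneg hx₁
    dsimp only
    gcongr
  · have ha : 0 < p / -s := div_pos hp (neg_pos.2 hs)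
    have hanti : AntitoneOn (fun x : ℝ => Real.log x / x ^ (p / -s))
        (Set.Ici (Real.exp (|s| / p))) := by
      simpa only [abs_of_neg hs, inv_div] using Real.log_div_self_rpow_antitoneOn ha
    have heq : ∀ x ∈ Set.Ici (Real.exp (|s| / p)),
        x ^ p * Real.log x ^ s = (Real.log x / x ^ (p / -s)) ^ s := fun x hx => by
      have hx₀ : 0 ≤ x := zero_le_one.trans (hone x hx)
      rw [Real.div_rpow (Real.log_nonneg (hone x hx)) (Real.rpow_nonneg hx₀ _), ← Real.rpow_mul hx₀,
        div_neg, neg_mul, div_mul_cancel₀ _ hs.ne, Real.rpow_neg hx₀, div_inv_eq_mul, mul_comm]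
    have hpos : ∀ x ∈ Set.Ici (Real.exp (|s| / p)), 0 < Real.log x / x ^ (p / -s) := fun x hx => by
      have hlt : 1 < x := (Real.one_lt_exp_iff.2 (div_pos (abs_pos.2 hs.ne) hp)).trans_le hx
      exact div_pos (Real.log_pos hlt) (Real.rpow_pos_of_pos (zero_lt_one.trans hlt) _)
    intro x hx y hy hxy
    dsimp only
    rw [heq x hx, heq y hy]
    exact Real.rpow_le_rpow_of_nonpos (hpos y hy) (hanti hx hy hxy) hs.le

lemma isBigO_sum_range_rpow_mul_log_rpow {r : ℝ} (hr : r < 1) (s : ℝ) :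
    (fun k => ∑ l ∈ Finset.range k, (l : ℝ) ^ (-r) * Real.log l ^ s) =O[atTop]
      fun k : ℕ => (k : ℝ) * ((k : ℝ) ^ (-r) * Real.log k ^ s) := by
  set t := min 1 ((1 - r) / 2)
  have ht₀ : 0 < t := lt_min one_pos (by linarith)
  have ht₁ : t ≤ 1 := min_le_left _ _
  have hp : 0 < 1 - t - r := by linarith [min_le_right 1 ((1 - r) / 2)]
  refine isBigO_sum_range_of_monotoneOn (N := ⌈Real.exp (|s| / (1 - t - r))⌉₊) ht₀ ht₁ ?_ ?_
  · filter_upwards [eventually_gt_atTop 1] with k hk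
    have hlog : 0 < Real.log k := Real.log_pos (Nat.one_lt_cast.2 hk)
    positivity
  · intro j hj k hk hjk
    have hexp : ∀ i ∈ Set.Ici ⌈Real.exp (|s| / (1 - t - r))⌉₊, Real.exp (|s| / (1 - t - r)) ≤ i :=
      fun i => Nat.ceil_le.1
    have heq : ∀ i ∈ Set.Ici ⌈Real.exp (|s| / (1 - t - r))⌉₊,
        (i : ℝ) ^ (1 - t) * ((i : ℝ) ^ (-r) * Real.log i ^ s) =
          (i : ℝ) ^ (1 - t - r) * Real.log i ^ s := fun i hi => by
      rw [← mul_assoc, ← Real.rpow_add ((Real.exp_pos _).trans_le (hexp i hi)), ← sub_eq_add_neg]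
    dsimp only
    rw [heq j hj, heq k hk]
    exact monotoneOn_rpow_mul_log_rpow hp s (hexp j hj) (hexp k hk) (Nat.cast_le.2 hjk)

lemma le_of_rpow_isBigO_rpow_mul_log_rpow {t r s : ℝ}
    (h : (fun k : ℕ => (k : ℝ) ^ (-t)) =O[atTop] fun k : ℕ => (k : ℝ) ^ (-r) * Real.log k ^ s) :
    r ≤ t := by
  by_contra! hlt
  have hlog : (fun k : ℕ => Real.log k ^ s) =o[atTop] fun k : ℕ => (k : ℝ) ^ (r - t) :=
    (isLittleO_log_rpow_rpow_atTop s (sub_pos.2 hlt)).comp_tendsto tendsto_natCast_atTop_atTop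
  have hlittle : (fun k : ℕ => (k : ℝ) ^ (-r) * Real.log k ^ s) =o[atTop]
      fun k : ℕ => (k : ℝ) ^ (-t) := by
    refine ((isBigO_refl (fun k : ℕ => (k : ℝ) ^ (-r)) atTop).mul_isLittleO hlog).congr'
      EventuallyEq.rfl ?_
    filter_upwards [eventually_gt_atTop 0] with k hk
    rw [← Real.rpow_add (by positivity), neg_add_eq_sub, sub_sub_cancel_left]
  refine isLittleO_irrefl ((eventually_gt_atTop 0).mono fun k hk => ?_).frequently
    (h.trans_isLittleO hlittle)
  positivity

lemma rpow_le_prod_one_sub_mul_stepSize {t : ℝ} (ht₀ : 0 ≤ t) (ht₁ : t ≤ 1) (k : ℕ) :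
    (1 - t) * ((k + 1 : ℕ) : ℝ) ^ (-t) ≤
      ∏ l ∈ Finset.range (k + 1), (1 - t * MDP.stepSize l) := by
  induction k with
  | zero => simp [MDP.stepSize]
  | succ k ih =>
    have hk : (0 : ℝ) < ((k + 1 : ℕ) : ℝ) := by positivity
    have hfactor : ((k + 1 : ℕ) : ℝ) ^ t / ((k + 1 + 1 : ℕ) : ℝ) ^ t ≤
        1 - t * MDP.stepSize (k + 1) := by
      rw [MDP.stepSize, mul_one_div, ← Real.div_rpow hk.le (by positivity), Nat.cast_succ (k + 1)]
      exact div_succ_rpow_le ht₀ ht₁ (k + 1)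
    rw [Finset.prod_range_succ]
    refine le_trans (le_of_eq ?_)
      (mul_le_mul ih hfactor (by positivity)
        (le_trans (by have := sub_nonneg.2 ht₁; positivity) ih))
    have := (Real.rpow_pos_of_pos hk t).ne'
    rw [Real.rpow_neg hk.le, Real.rpow_neg (by positivity)]
    field_simp

lemma rpow_isBigO_prod_one_sub_mul_stepSize {t : ℝ} (ht₀ : 0 ≤ t) (ht₁ : t < 1) :
    (fun k : ℕ => (k : ℝ) ^ (-t)) =O[atTop]
      fun k => ∏ l ∈ Finset.range k, (1 - t * MDP.stepSize l) := by
  refine IsBigO.of_bound (1 - t)⁻¹ ?_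
  filter_upwards [eventually_gt_atTop 0] with k hk
  obtain ⟨j, rfl⟩ := Nat.exists_eq_add_one.2 hk
  rw [Real.norm_of_nonneg (by positivity), ← div_eq_inv_mul, le_div_iff₀' (sub_pos.2 ht₁)]
  exact (rpow_le_prod_one_sub_mul_stepSize ht₀ ht₁.le j).trans (le_abs_self _)

end SumRate

lemma le_of_hasSum_of_le_add_mul {a f : ℕ → ℝ} {γ b V : ℝ} (hγ₀ : 0 ≤ γ) (hγ₁ : γ < 1)
    (ha : ∀ t, a t ≤ b) (hf : HasSum (fun t => γ ^ t * f t) V)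
    (h : ∀ t, a t ≤ f t + γ * a (t + 1)) : a 0 ≤ V := by
  have hstep : ∀ n, a 0 ≤ ∑ t ∈ Finset.range n, γ ^ t * f t + γ ^ n * a n := fun n => by
    induction n with
    | zero => simp
    | succ n ih =>
      rw [Finset.sum_range_succ, pow_succ]
      linarith [mul_le_mul_of_nonneg_left (h n) (pow_nonneg hγ₀ n)]
  have hunroll : ∀ n, a 0 ≤ ∑ t ∈ Finset.range n, γ ^ t * f t + γ ^ n * b := fun n =>
    (hstep n).trans (by gcongr; exact ha n)
  have hlim := hf.tendsto_sum_nat.add ((tendsto_pow_atTop_nhds_zero_of_lt_one hγ₀ hγ₁).mul_const b)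
  rw [zero_mul, add_zero] at hlim
  exact ge_of_tendsto' hlim hunroll

namespace MDP

variable {S A : Type*}

section ExpectNext

variable [Fintype S] (M : MDP S A) (z : S × A)

/-- The expected value of `g` at the next state after taking action `z.2` in state `z.1`. -/
noncomputable def expectNext (g : S → ℝ) : ℝ :=
  ∑ s', (M.P z.1 z.2 s').toReal * g s'

lemma sum_toReal_P : ∑ s', (M.P z.1 z.2 s').toReal = 1 := by
  rw [← ENNReal.toReal_sum fun s' _ => (M.P z.1 z.2).apply_ne_top s',
    ← tsum_fintype (L := .unconditional S), (M.P z.1 z.2).tsum_coe, ENNReal.toReal_one]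

lemma integral_toMeasure_P [MeasurableSpace S] [MeasurableSingletonClass S] (g : S → ℝ) :
    ∫ s', g s' ∂(M.P z.1 z.2).toMeasure = M.expectNext z g :=
  PMF.integral_eq_sum _ _

lemma expectNext_const_add_mul (a b : ℝ) (g : S → ℝ) :
    M.expectNext z (fun s' => a + b * g s') = a + b * M.expectNext z g := by
  simp only [expectNext, mul_add, Finset.sum_add_distrib, ← Finset.sum_mul, sum_toReal_P, one_mul,
    Finset.mul_sum, mul_left_comm]

lemma abs_expectNext_sub_le {g h : S → ℝ} {b : ℝ} (hb : ∀ s', |g s' - h s'| ≤ b) :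
    |M.expectNext z g - M.expectNext z h| ≤ b := by
  rw [expectNext, expectNext, ← Finset.sum_sub_distrib]
  calc |∑ s', ((M.P z.1 z.2 s').toReal * g s' - (M.P z.1 z.2 s').toReal * h s')|
      ≤ ∑ s', (M.P z.1 z.2 s').toReal * b := by
        refine Finset.abs_sum_le_sum_abs _ _ |>.trans (Finset.sum_le_sum fun s' _ => ?_)
        rw [← mul_sub, abs_mul, abs_of_nonneg ENNReal.toReal_nonneg]
        exact mul_le_mul_of_nonneg_left (hb s') ENNReal.toReal_nonneg
    _ = b := by rw [← Finset.sum_mul, sum_toReal_P, one_mul]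

end ExpectNext

section Value

variable [Fintype S] [MeasurableSpace S] [MeasurableSingletonClass S]
  (M : MDP S A) (π : S → A) (s : S)

instance : IsProbabilityMeasure (M.trajLaw π s) :=
  inferInstanceAs (IsProbabilityMeasure
    (Kernel.trajMeasure (X := fun _ => S) (Measure.dirac s) (M.stepKernel π)))

lemma integrable_trajLaw (g : S → ℝ) (t : ℕ) : Integrable (fun w => g (w t)) (M.trajLaw π s) :=
  Integrable.comp_measurable .of_finite (measurable_pi_apply t)

lemma integral_trajLaw_zero (g : S → ℝ) : ∫ w, g (w 0) ∂(M.trajLaw π s) = g s := by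
  have hmap : (M.trajLaw π s).map (fun w => w 0) = Measure.dirac s := by
    have heval : (fun w : ℕ → S => w 0) =
        (fun h : (i : Finset.Iic 0) → (fun _ : ℕ => S) i => h ⟨0, Finset.mem_Iic.2 le_rfl⟩) ∘
          Preorder.frestrictLe (π := fun _ => S) 0 := rfl
    rw [heval, ← Measure.map_map (measurable_pi_apply _) (by fun_prop), trajLaw,
      Kernel.trajMeasure, Measure.map_comp _ _ (by fun_prop), Kernel.traj_map_frestrictLe,
      Kernel.partialTraj_self, Measure.id_comp]
    exact (congrArg _ (Measure.map_dirac' (MeasurableEquiv.measurable _) s)).trans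
      (Measure.map_dirac' (measurable_pi_apply _) _)
  rw [← integral_dirac g s, ← hmap]
  exact (integral_map (measurable_pi_apply 0).aemeasurable
    (measurable_of_finite g).aestronglyMeasurable).symm

lemma integral_trajLaw_succ (g : S → ℝ) (t : ℕ) :
    ∫ w, g (w (t + 1)) ∂(M.trajLaw π s) =
      ∫ w, M.expectNext (w t, π (w t)) g ∂(M.trajLaw π s) := by
  have hcomp := Kernel.map_frestrictLe_trajMeasure_compProd_eq_map_trajMeasure
    (X := fun _ => S) (μ₀ := Measure.dirac s) (κ := M.stepKernel π) (a := t)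
  change (M.trajLaw π s).map _ ⊗ₘ _ = (M.trajLaw π s).map _ at hcomp
  have hg : Measurable fun p : ((i : Finset.Iic t) → (fun _ : ℕ => S) i) × S => g p.2 :=
    (measurable_of_finite g).comp measurable_snd
  have hpair : Measurable fun w : ℕ → S =>
      (Preorder.frestrictLe (π := fun _ => S) t w, w (t + 1)) := by fun_prop
  have hint := integral_map (μ := M.trajLaw π s) hpair.aemeasurable hg.aestronglyMeasurable
  have hgint : Integrable (fun p : ((i : Finset.Iic t) → (fun _ : ℕ => S) i) × S => g p.2)
      ((M.trajLaw π s).map (Preorder.frestrictLe (π := fun _ => S) t) ⊗ₘ M.stepKernel π t) :=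
    .of_finite
  rw [← hcomp, Measure.integral_compProd hgint,
    integral_map (by fun_prop) (measurable_of_finite _).aestronglyMeasurable] at hint
  rw [← hint]
  exact integral_congr_ae (Eventually.of_forall fun w => M.integral_toMeasure_P (w t, π (w t)) g)

lemma hasSum_value :
    HasSum (fun t => M.γ ^ t * ∫ w, M.c (w t, π (w t)) ∂(M.trajLaw π s)) (M.value π s) := by
  set cost : S → ℝ := fun x => M.c (x, π x)
  obtain ⟨b, hb⟩ := (Set.finite_range fun x => ‖cost x‖).bddAbove
  have hint : ∀ t, Integrable (fun w : ℕ → S => M.γ ^ t * cost (w t)) (M.trajLaw π s) := fun t =>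
    (M.integrable_trajLaw π s cost t).const_mul _
  have hsummable : Summable fun t => ∫ w, ‖M.γ ^ t * cost (w t)‖ ∂(M.trajLaw π s) := by
    refine Summable.of_nonneg_of_le (fun t => integral_nonneg fun w => norm_nonneg _) (fun t => ?_)
      ((summable_geometric_of_lt_one M.γ_pos.le M.γ_lt_one).mul_right b)
    calc ∫ w, ‖M.γ ^ t * cost (w t)‖ ∂(M.trajLaw π s)
        ≤ ∫ _, M.γ ^ t * b ∂(M.trajLaw π s) := by
          refine integral_mono (hint t).norm (integrable_const _) fun w => ?_
          have hγ := pow_nonneg M.γ_pos.le t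
          simp only [norm_mul, Real.norm_of_nonneg hγ]
          exact mul_le_mul_of_nonneg_left (hb (Set.mem_range_self (w t))) hγ
      _ = M.γ ^ t * b := by simp
  have hsum := hasSum_integral_of_summable_integral_norm hint hsummable
  simp only [integral_const_mul] at hsum
  exact hsum

lemma integral_cost_add_mul_integral_succ (v : S → ℝ) (t : ℕ) :
    ∫ w, M.c (w t, π (w t)) ∂(M.trajLaw π s) + M.γ * ∫ w, v (w (t + 1)) ∂(M.trajLaw π s) =
      ∫ w, (M.c (w t, π (w t)) + M.γ * M.expectNext (w t, π (w t)) v) ∂(M.trajLaw π s) := by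
  rw [integral_trajLaw_succ, ← integral_const_mul]
  exact (integral_add (M.integrable_trajLaw π s (fun x => M.c (x, π x)) t)
    (M.integrable_trajLaw π s (fun x => M.γ * M.expectNext (x, π x) v) t)).symm

variable {M π}

lemma le_value_of_le {v : S → ℝ}
    (hv : ∀ x, v x ≤ M.c (x, π x) + M.γ * M.expectNext (x, π x) v) : v s ≤ M.value π s := by
  obtain ⟨b, hb⟩ := (Set.finite_range v).bddAbove
  rw [← M.integral_trajLaw_zero π s v]
  refine le_of_hasSum_of_le_add_mul (a := fun t => ∫ w, v (w t) ∂(M.trajLaw π s)) (b := b)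
    M.γ_pos.le M.γ_lt_one (fun t => ?_) (M.hasSum_value π s) fun t => ?_
  · exact (integral_mono (M.integrable_trajLaw π s v t) (integrable_const b) fun w =>
      hb (Set.mem_range_self (w t))).trans_eq (by simp)
  · rw [integral_cost_add_mul_integral_succ]
    exact integral_mono (M.integrable_trajLaw π s v t) (M.integrable_trajLaw π s
      (fun x => M.c (x, π x) + M.γ * M.expectNext (x, π x) v) t) fun w => hv (w t)

lemma value_le_of_le {v : S → ℝ}
    (hv : ∀ x, M.c (x, π x) + M.γ * M.expectNext (x, π x) v ≤ v x) : M.value π s ≤ v s := by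
  obtain ⟨b, hb⟩ := (Set.finite_range v).bddBelow
  have hsum := (M.hasSum_value π s).neg
  simp only [← mul_neg] at hsum
  rw [← M.integral_trajLaw_zero π s v, ← neg_le_neg_iff]
  refine le_of_hasSum_of_le_add_mul (a := fun t => -∫ w, v (w t) ∂(M.trajLaw π s)) (b := -b)
    M.γ_pos.le M.γ_lt_one (fun t => neg_le_neg ?_) hsum fun t => ?_
  · exact (integral_mono (integrable_const b) (M.integrable_trajLaw π s v t) fun w =>
      hb (Set.mem_range_self (w t))).trans_eq' (by simp)
  · rw [mul_neg, ← neg_add, neg_le_neg_iff, integral_cost_add_mul_integral_succ]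
    exact integral_mono (M.integrable_trajLaw π s (fun x => M.c (x, π x) + M.γ *
      M.expectNext (x, π x) v) t) (M.integrable_trajLaw π s v t) fun w => hv (w t)

end Value

section Bellman

variable [Fintype A] [Nonempty A]

lemma minQ_le (q : S × A → ℝ) (s : S) (a : A) : minQ q s ≤ q (s, a) :=
  Finset.inf'_le _ (Finset.mem_univ a)

lemma exists_minQ_eq (q : S × A → ℝ) (s : S) : ∃ a, minQ q s = q (s, a) := by
  obtain ⟨a, -, ha⟩ := Finset.exists_mem_eq_inf' Finset.univ_nonempty fun a => q (s, a)
  exact ⟨a, ha⟩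

lemma minQ_add_const (q : S × A → ℝ) (b : ℝ) (s : S) :
    minQ (q + Function.const _ b) s = minQ q s + b := by
  obtain ⟨a, ha⟩ := exists_minQ_eq q s
  obtain ⟨a', ha'⟩ := exists_minQ_eq (q + Function.const _ b) s
  have hle : minQ (q + Function.const _ b) s ≤ q (s, a) + b := minQ_le _ s a
  have hge : minQ (q + Function.const _ b) s = q (s, a') + b := ha'
  linarith [minQ_le q s a']

variable [Fintype S]

lemma abs_minQ_sub_le (q q' : S × A → ℝ) (s : S) : |minQ q s - minQ q' s| ≤ ‖q - q'‖ := by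
  obtain ⟨a, ha⟩ := exists_minQ_eq q s
  obtain ⟨a', ha'⟩ := exists_minQ_eq q' s
  have hcoord : ∀ a, |q (s, a) - q' (s, a)| ≤ ‖q - q'‖ := fun a => norm_le_pi_norm (q - q') (s, a)
  rw [abs_sub_le_iff]
  exact ⟨by linarith [minQ_le q s a', (abs_sub_le_iff.1 (hcoord a')).1],
    by linarith [minQ_le q' s a, (abs_sub_le_iff.1 (hcoord a)).2]⟩

variable (M : MDP S A)

lemma bellmanQ_apply (q : S × A → ℝ) (z : S × A) :
    M.bellmanQ q z = M.c z + M.γ * M.expectNext z (minQ q) := rfl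

lemma norm_bellmanQ_sub_le (q q' : S × A → ℝ) :
    ‖M.bellmanQ q - M.bellmanQ q'‖ ≤ M.γ * ‖q - q'‖ := by
  refine (pi_norm_le_iff_of_nonneg (mul_nonneg M.γ_pos.le (norm_nonneg _))).2 fun z => ?_
  rw [Pi.sub_apply, bellmanQ_apply, bellmanQ_apply, add_sub_add_left_eq_sub, ← mul_sub, norm_mul,
    Real.norm_of_nonneg M.γ_pos.le]
  exact mul_le_mul_of_nonneg_left (M.abs_expectNext_sub_le z (abs_minQ_sub_le q q')) M.γ_pos.le

lemma exists_eq_bellmanQ : ∃ q : S × A → ℝ, q = M.bellmanQ q := by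
  have hcontract : ContractingWith ⟨M.γ, M.γ_pos.le⟩ M.bellmanQ :=
    ⟨M.γ_lt_one, LipschitzWith.of_dist_le_mul fun q q' => by
      rw [dist_eq_norm, dist_eq_norm]
      exact M.norm_bellmanQ_sub_le q q'⟩
  exact ⟨_, hcontract.fixedPoint_isFixedPt.symm⟩

lemma isOptimalQ_of_eq_bellmanQ [MeasurableSpace S] [MeasurableSingletonClass S]
    {q : S × A → ℝ} (hq : q = M.bellmanQ q) : M.IsOptimalQ q := by
  choose π hπ using exists_minQ_eq q
  have hgreedy : ∀ s, minQ q s = M.c (s, π s) + M.γ * M.expectNext (s, π s) (minQ q) := fun s =>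
    (hπ s).trans (congrFun hq (s, π s))
  have hvalue : M.value π = minQ q := funext fun s =>
    le_antisymm (value_le_of_le s fun x => (hgreedy x).ge)
      (le_value_of_le s fun x => (hgreedy x).le)
  refine ⟨π, fun π' s => ?_, ?_⟩
  · rw [hvalue]
    exact le_value_of_le s fun x => (minQ_le q x (π' x)).trans (congrFun hq (x, π' x)).le
  · funext z
    rw [qValue, hvalue]
    exact congrFun hq z

end Bellman

section QLearning

variable [Fintype A] [Nonempty A] (M : MDP S A)

lemma empBellmanQ_add_const (x : S × A → S) (q : S × A → ℝ) (b : ℝ) :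
    M.empBellmanQ x (q + Function.const _ b) =
      M.empBellmanQ x q + Function.const _ (M.γ * b) := by
  funext z
  simp only [empBellmanQ, minQ_add_const, Pi.add_apply, Function.const_apply]
  ring

lemma qlIter_succ (x : ℕ → S × A → S) (q₀ : S × A → ℝ) (k : ℕ) :
    M.qlIter x q₀ (k + 1) = (1 - stepSize k) • M.qlIter x q₀ k +
      stepSize k • M.empBellmanQ (x k) (M.qlIter x q₀ k) := by
  funext z
  simp only [qlIter, Pi.add_apply, Pi.smul_apply, smul_eq_mul]
  ring

lemma qlIter_add_const (x : ℕ → S × A → S) (q₀ : S × A → ℝ) (b : ℝ) (k : ℕ) :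
    M.qlIter x (q₀ + Function.const _ b) k = M.qlIter x q₀ k +
      Function.const _ (b * ∏ l ∈ Finset.range k, (1 - (1 - M.γ) * stepSize l)) := by
  induction k with
  | zero => simp [qlIter]
  | succ k ih =>
    rw [qlIter_succ, qlIter_succ, ih, empBellmanQ_add_const, Finset.prod_range_succ]
    funext z
    simp only [Pi.add_apply, Pi.smul_apply, smul_eq_mul, Function.const_apply]
    ring

variable [Fintype S]

lemma norm_empBellmanQ_sub_le (x : S × A → S) (q q' : S × A → ℝ) :
    ‖M.empBellmanQ x q - M.empBellmanQ x q'‖ ≤ M.γ * ‖q - q'‖ := by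
  refine (pi_norm_le_iff_of_nonneg (mul_nonneg M.γ_pos.le (norm_nonneg _))).2 fun z => ?_
  rw [Pi.sub_apply, empBellmanQ, empBellmanQ, add_sub_add_left_eq_sub, ← mul_sub, norm_mul,
    Real.norm_of_nonneg M.γ_pos.le]
  exact mul_le_mul_of_nonneg_left (abs_minQ_sub_le q q' (x z)) M.γ_pos.le

lemma runningAvg_empBellmanQ_qlIter (x : ℕ → S × A → S) (q₀ : S × A → ℝ) {k : ℕ} (hk : 0 < k) :
    runningAvg (fun l => M.empBellmanQ (x l) (M.qlIter x q₀ l)) k = M.qlIter x q₀ k := by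
  induction k, hk using Nat.le_induction with
  | base => rw [runningAvg_succ, qlIter_succ]; simp [stepSize]
  | succ k _ ih => rw [runningAvg_succ, qlIter_succ, ih]

lemma norm_qlIter_sub_le (x : ℕ → S × A → S) (q₀ p : S × A → ℝ) {k : ℕ} (hk : 0 < k) :
    ‖M.qlIter x q₀ k - p‖ ≤ M.γ * runningAvg (fun l => ‖M.qlIter x q₀ l - p‖) k +
      ‖runningAvg (fun l => M.empBellmanQ (x l) p) k - p‖ := by
  have hsplit : M.qlIter x q₀ k - p =
      runningAvg (fun l => M.empBellmanQ (x l) (M.qlIter x q₀ l) - M.empBellmanQ (x l) p) k +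
        (runningAvg (fun l => M.empBellmanQ (x l) p) k - p) := by
    rw [runningAvg_sub, M.runningAvg_empBellmanQ_qlIter x q₀ hk, sub_add_sub_cancel]
  rw [hsplit, ← runningAvg_const_mul]
  refine (norm_add_le _ _).trans (add_le_add_left ((norm_runningAvg_le _ k).trans ?_) _)
  exact runningAvg_le_runningAvg fun l _ => M.norm_empBellmanQ_sub_le (x l) _ _

lemma norm_runningAvg_residual_le (x : ℕ → S × A → S) (q₀ p : S × A → ℝ) (k : ℕ) :
    ‖runningAvg (fun l => M.empBellmanQ (x l) (M.qlIter x q₀ l) - M.qlIter x q₀ l) k‖ ≤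
      addRunningAvg (fun l => ‖M.qlIter x q₀ l - p‖) k := by
  rcases k.eq_zero_or_pos with rfl | hk
  · simp [addRunningAvg]
  have hsplit : runningAvg (fun l => M.empBellmanQ (x l) (M.qlIter x q₀ l) - M.qlIter x q₀ l) k =
      (M.qlIter x q₀ k - p) - runningAvg (fun l => M.qlIter x q₀ l - p) k := by
    rw [runningAvg_sub, runningAvg_sub, M.runningAvg_empBellmanQ_qlIter x q₀ hk,
      runningAvg_const p hk, sub_sub_sub_cancel_right]
  rw [hsplit]
  exact (norm_sub_le _ _).trans (add_le_add_right (norm_runningAvg_le _ k) _)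

lemma tendsto_norm_qlIter_sub (x : ℕ → S × A → S) (q₀ : S × A → ℝ) {p : S × A → ℝ}
    (hp : Tendsto (runningAvg fun l => M.empBellmanQ (x l) p) atTop (𝓝 p)) :
    Tendsto (fun k => ‖M.qlIter x q₀ k - p‖) atTop (𝓝 0) :=
  tendsto_zero_of_le_mul_runningAvg_add M.γ_pos.le M.γ_lt_one (fun _ => norm_nonneg _)
    (tendsto_iff_norm_sub_tendsto_zero.1 hp) fun _ => M.norm_qlIter_sub_le x q₀ p

lemma lt_one_of_isBigO_qlIter [Nonempty S] {x : ℕ → S × A → S} {q₀ p : S × A → ℝ} {r s : ℝ}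
    (h₀ : (fun k => ‖M.qlIter x q₀ k - p‖) =O[atTop]
      fun k : ℕ => (k : ℝ) ^ (-r) * Real.log k ^ s)
    (h₁ : (fun k => ‖M.qlIter x (q₀ + Function.const _ 1) k - p‖) =O[atTop]
      fun k : ℕ => (k : ℝ) ^ (-r) * Real.log k ^ s) : r < 1 := by
  have hprod : (fun k => ∏ l ∈ Finset.range k, (1 - (1 - M.γ) * stepSize l)) =O[atTop]
      fun k : ℕ => (k : ℝ) ^ (-r) * Real.log k ^ s := by
    refine (IsBigO.of_norm_le fun k => ?_).trans (h₁.add h₀)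
    have hdiff : Function.const (S × A) (∏ l ∈ Finset.range k, (1 - (1 - M.γ) * stepSize l)) =
        (M.qlIter x (q₀ + Function.const _ 1) k - p) - (M.qlIter x q₀ k - p) := by
      rw [qlIter_add_const, one_mul, sub_sub_sub_cancel_right, add_sub_cancel_left]
    rw [← pi_norm_const (ι := S × A)]
    exact (congrArg norm hdiff).trans_le (norm_sub_le _ _)
  have hγ := M.γ_pos
  have hr := le_of_rpow_isBigO_rpow_mul_log_rpow <|
    (rpow_isBigO_prod_one_sub_mul_stepSize (sub_nonneg.2 M.γ_lt_one.le)
      (sub_lt_self 1 hγ)).trans hprod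
  linarith

end QLearning

section RankOne

variable [Fintype A] [Nonempty A] [Fintype S]

/-- A run `q` of Q-learning with a rank-one correction along arbitrary weight vectors `w k` of total
mass one which are bounded and vary by `O(1/k)` per iteration. R1-QL is the case in which `w k` is
the probability vector `d_k`. -/
structure IsRankOneRun (M : MDP S A) (x : ℕ → S × A → S) (q₀ : S × A → ℝ)
    (w q : ℕ → S × A → ℝ) : Prop where
  q_zero : q 0 = q₀
  sum_eq_one : ∀ k, ∑ z, w k z = 1
  exists_bound : ∃ b : ℝ, ∀ (k : ℕ) z, |w k z| ≤ b ∧ |w (k + 1) z - w k z| ≤ b / ((k : ℝ) + 1)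
  q_succ : ∀ k, q (k + 1) = (1 - stepSize k) • q k + stepSize k • (M.empBellmanQ (x k) (q k) +
    Function.const _ (M.γ / (1 - M.γ) * w k ⬝ᵥ (M.empBellmanQ (x k) (q k) - q k)))

namespace IsRankOneRun

variable {M : MDP S A} {x : ℕ → S × A → S} {q₀ : S × A → ℝ} {w q : ℕ → S × A → ℝ}

lemma eq_qlIter_add (h : M.IsRankOneRun x q₀ w q) (k : ℕ) :
    q k = M.qlIter x q₀ k + Function.const _ (M.γ / (1 - M.γ) * runningAvg (fun l =>
      w l ⬝ᵥ (M.empBellmanQ (x l) (M.qlIter x q₀ l) - M.qlIter x q₀ l)) k) := by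
  induction k with
  | zero => rw [h.q_zero, runningAvg_zero, mul_zero]; exact (add_zero q₀).symm
  | succ k ih =>
    set Q := M.qlIter x q₀ k
    set e := M.γ / (1 - M.γ) * runningAvg (fun l =>
      w l ⬝ᵥ (M.empBellmanQ (x l) (M.qlIter x q₀ l) - M.qlIter x q₀ l)) k with he
    have hγ : 1 - M.γ ≠ 0 := (sub_pos.2 M.γ_lt_one).ne'
    have hresidual : w k ⬝ᵥ (M.empBellmanQ (x k) (q k) - q k) =
        w k ⬝ᵥ (M.empBellmanQ (x k) Q - Q) - (1 - M.γ) * e := by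
      have hconst : M.empBellmanQ (x k) (q k) - q k =
          (M.empBellmanQ (x k) Q - Q) - Function.const _ ((1 - M.γ) * e) := by
        rw [ih, empBellmanQ_add_const]
        funext z
        simp only [Pi.add_apply, Pi.sub_apply, Function.const_apply]
        ring
      rw [hconst, dotProduct_sub]
      simp only [dotProduct, Function.const_apply, ← Finset.sum_mul, h.sum_eq_one, one_mul]
    rw [h.q_succ, hresidual, ih, empBellmanQ_add_const, qlIter_succ, runningAvg_succ]
    funext z
    simp only [Pi.add_apply, Pi.smul_apply, smul_eq_mul, Function.const_apply, mul_add]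
    rw [mul_left_comm _ (1 - stepSize k), ← he]
    field_simp
    ring

lemma nonempty (h : M.IsRankOneRun x q₀ w q) : Nonempty (S × A) := by
  by_contra! hempty
  simpa using h.sum_eq_one 0

lemma exists_norm_sub_le (h : M.IsRankOneRun x q₀ w q) (p : S × A → ℝ) :
    ∃ C : ℝ, ∀ k, ‖q k - p‖ ≤
      C * addRunningAvg (addRunningAvg fun l => ‖M.qlIter x q₀ l - p‖) k := by
  obtain ⟨b, hb⟩ := h.exists_bound
  obtain ⟨z⟩ := h.nonempty
  have hb₀ : 0 ≤ b := (abs_nonneg _).trans (hb 0 z).1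
  have hγ : 0 ≤ M.γ / (1 - M.γ) := div_nonneg M.γ_pos.le (sub_pos.2 M.γ_lt_one).le
  set ε : ℕ → ℝ := fun l => ‖M.qlIter x q₀ l - p‖
  set residual : ℕ → S × A → ℝ := fun l =>
    M.empBellmanQ (x l) (M.qlIter x q₀ l) - M.qlIter x q₀ l
  have hε : ∀ l, 0 ≤ ε l := fun l => norm_nonneg _
  have hql : ∀ k, ε k ≤ addRunningAvg (addRunningAvg ε) k := fun k =>
    (le_addRunningAvg hε k).trans (le_addRunningAvg (addRunningAvg_nonneg hε) k)
  have hshift : ∀ k, |runningAvg (fun l => w l ⬝ᵥ residual l) k| ≤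
      Fintype.card (S × A) * b * addRunningAvg (addRunningAvg ε) k := fun k =>
    (abs_runningAvg_dotProduct_le (fun k z => (hb k z).1) (fun k z => (hb k z).2) residual k).trans
      <| mul_le_mul_of_nonneg_left
        (addRunningAvg_le_addRunningAvg (M.norm_runningAvg_residual_le x q₀ p) k) (by positivity)
  refine ⟨1 + M.γ / (1 - M.γ) * (Fintype.card (S × A) * b), fun k => ?_⟩
  calc ‖q k - p‖
      ≤ ε k + |M.γ / (1 - M.γ) * runningAvg (fun l => w l ⬝ᵥ residual l) k| := by
        rw [h.eq_qlIter_add, add_sub_right_comm]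
        exact (norm_add_le _ _).trans (add_le_add_right (pi_norm_const_le _) _)
    _ ≤ addRunningAvg (addRunningAvg ε) k + M.γ / (1 - M.γ) *
          (Fintype.card (S × A) * b * addRunningAvg (addRunningAvg ε) k) := by
        rw [abs_mul, abs_of_nonneg hγ]
        exact add_le_add (hql k) (mul_le_mul_of_nonneg_left (hshift k) hγ)
    _ = _ := by ring

lemma tendsto (h : M.IsRankOneRun x q₀ w q) {p : S × A → ℝ}
    (hp : Tendsto (fun k => ‖M.qlIter x q₀ k - p‖) atTop (𝓝 0)) : Tendsto q atTop (𝓝 p) := by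
  obtain ⟨C, hC⟩ := h.exists_norm_sub_le p
  have hlim := (tendsto_addRunningAvg (tendsto_addRunningAvg hp)).const_mul C
  rw [mul_zero] at hlim
  exact tendsto_iff_norm_sub_tendsto_zero.2 (squeeze_zero (fun _ => norm_nonneg _) hC hlim)

lemma isBigO (h : M.IsRankOneRun x q₀ w q) {p : S × A → ℝ} {ρ : ℕ → ℝ} (hρ : 0 < ρ)
    (hsum : (fun k => ∑ l ∈ Finset.range k, ρ l) =O[atTop] fun k => (k : ℝ) * ρ k)
    (hp : (fun k => ‖M.qlIter x q₀ k - p‖) =O[atTop] ρ) :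
    (fun k => ‖q k - p‖) =O[atTop] ρ := by
  obtain ⟨C, hC⟩ := h.exists_norm_sub_le p
  refine (IsBigO.of_norm_le fun k => ?_).trans
    ((isBigO_addRunningAvg hρ hsum (isBigO_addRunningAvg hρ hsum hp)).const_mul_left C)
  exact (norm_norm _).trans_le (hC k)

lemma isBigO_rpow_mul_log_rpow (h : M.IsRankOneRun x q₀ w q) {p : S × A → ℝ} {r s : ℝ}
    (h₀ : (fun k => ‖M.qlIter x q₀ k - p‖) =O[atTop]
      fun k : ℕ => (k : ℝ) ^ (-r) * Real.log k ^ s)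
    (h₁ : (fun k => ‖M.qlIter x (q₀ + Function.const _ 1) k - p‖) =O[atTop]
      fun k : ℕ => (k : ℝ) ^ (-r) * Real.log k ^ s) :
    (fun k => ‖q k - p‖) =O[atTop] fun k : ℕ => (k : ℝ) ^ (-r) * Real.log k ^ s := by
  obtain ⟨z⟩ := h.nonempty
  have : Nonempty S := ⟨z.1⟩
  have hpos : (0 : ℕ → ℝ) < fun k : ℕ => (k : ℝ) ^ (-r) * Real.log k ^ s := by
    refine Pi.lt_def.2 ⟨fun k => ?_, 2, ?_⟩
    · exact mul_nonneg (by positivity) (Real.rpow_nonneg (Real.log_natCast_nonneg k) s)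
    · have hlog : 0 < Real.log (2 : ℕ) := Real.log_pos (by norm_num)
      exact mul_pos (by positivity) (Real.rpow_pos_of_pos hlog s)
  exact h.isBigO hpos (isBigO_sum_range_rpow_mul_log_rpow (M.lt_one_of_isBigO_qlIter h₀ h₁) s) h₀

end IsRankOneRun

end RankOne

section R1QL

variable [Fintype A] [Fintype S]

lemma pushMass_mem_stdSimplex (x : S × A → S) (a : S × A → A) {d : S × A → ℝ}
    (hd : d ∈ stdSimplex ℝ (S × A)) : pushMass x a d ∈ stdSimplex ℝ (S × A) := by
  classical
  refine ⟨fun y => Finset.sum_nonneg fun z _ => ?_, ?_⟩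
  · split_ifs
    exacts [hd.1 z, le_rfl]
  · simp only [pushMass]
    rw [Finset.sum_comm, ← hd.2]
    exact Finset.sum_congr rfl fun z _ => by simp

lemma normalizeL1_of_mem_stdSimplex {d : S × A → ℝ} (hd : d ∈ stdSimplex ℝ (S × A)) :
    normalizeL1 d = d := by
  funext y
  rw [normalizeL1, Finset.sum_congr rfl fun z _ => abs_of_nonneg (hd.1 z), hd.2, div_one]

lemma smul_add_smul_pushMass_mem_stdSimplex (x : S × A → S) (a : S × A → A) {d : S × A → ℝ}
    (hd : d ∈ stdSimplex ℝ (S × A)) (k : ℕ) :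
    (1 - stepSize k) • d + stepSize k • pushMass x a d ∈ stdSimplex ℝ (S × A) := by
  have hk : (1 : ℝ) ≤ (k : ℝ) + 1 := by simp
  have hle : stepSize k ≤ 1 := div_le_one_of_le₀ hk (by positivity)
  exact convex_stdSimplex ℝ (S × A) hd (pushMass_mem_stdSimplex x a hd)
    (sub_nonneg.2 hle) (by rw [stepSize]; positivity) (sub_add_cancel _ _)

namespace IsR1QLRun

variable [Nonempty A] {M : MDP S A} {x : ℕ → S × A → S} {q₀ d₀ : S × A → ℝ} {q d : ℕ → S × A → ℝ}
  {a : ℕ → S × A → A}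

lemma d_mem_stdSimplex (h : M.IsR1QLRun x q₀ d₀ q d a) (hd₀ : d₀ ∈ stdSimplex ℝ (S × A)) (k : ℕ) :
    d k ∈ stdSimplex ℝ (S × A) := by
  induction k with
  | zero => rwa [h.d_zero]
  | succ k ih =>
    have hmem := smul_add_smul_pushMass_mem_stdSimplex (x k) (a k) ih k
    rwa [h.d_succ, normalizeL1_of_mem_stdSimplex hmem]

lemma abs_d_sub_le (h : M.IsR1QLRun x q₀ d₀ q d a) (hd₀ : d₀ ∈ stdSimplex ℝ (S × A)) (k : ℕ)
    (z : S × A) : |d (k + 1) z - d k z| ≤ stepSize k := by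
  have hd := h.d_mem_stdSimplex hd₀ k
  have hpush := pushMass_mem_stdSimplex (x k) (a k) hd
  have hstep : 0 ≤ stepSize k := by rw [stepSize]; positivity
  have hdiff : d (k + 1) z - d k z = stepSize k * (pushMass (x k) (a k) (d k) z - d k z) := by
    rw [h.d_succ, normalizeL1_of_mem_stdSimplex
      (smul_add_smul_pushMass_mem_stdSimplex (x k) (a k) hd k)]
    simp only [Pi.add_apply, Pi.smul_apply, smul_eq_mul]
    ring
  have hdz := mem_Icc_of_mem_stdSimplex hd z
  have hpz := mem_Icc_of_mem_stdSimplex hpush z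
  rw [hdiff, abs_mul, abs_of_nonneg hstep]
  exact mul_le_of_le_one_right hstep
    (abs_sub_le_iff.2 ⟨by linarith [hdz.1, hpz.2], by linarith [hdz.2, hpz.1]⟩)

lemma isRankOneRun (h : M.IsR1QLRun x q₀ d₀ q d a) (hd₀ : d₀ ∈ stdSimplex ℝ (S × A)) :
    M.IsRankOneRun x q₀ (fun k => d (k + 1)) q where
  q_zero := h.q_zero
  sum_eq_one k := (h.d_mem_stdSimplex hd₀ (k + 1)).2
  exists_bound := by
    refine ⟨1, fun k z => ⟨?_, (h.abs_d_sub_le hd₀ (k + 1) z).trans ?_⟩⟩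
    · have hdz := mem_Icc_of_mem_stdSimplex (h.d_mem_stdSimplex hd₀ (k + 1)) z
      exact (abs_of_nonneg hdz.1).trans_le hdz.2
    · exact one_div_le_one_div_of_le (by positivity) (by gcongr; exact k.le_succ)
  q_succ k := by
    funext z
    rw [h.q_succ]
    simp only [Pi.add_apply, Pi.smul_apply, smul_eq_mul, Function.const_apply, dotProduct,
      Pi.sub_apply]
    ring

end IsR1QLRun

end R1QL

section Sampling

variable [Fintype S] {Ω : Type*} [MeasurableSpace Ω]

/-- The law of large numbers for the sampled next states: for every pair `z` and every function `g`
of the next state, the running averages of `g` along the samples for `z` converge almost surely to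
the expectation of `g` under `P(· | z)`. -/
def ObeysLLN (M : MDP S A) (μ : Measure Ω) (X : ℕ → S × A → Ω → S) : Prop :=
  ∀ (z : S × A) (g : S → ℝ),
    ∀ᵐ ω ∂μ, Tendsto (runningAvg fun l => g (X l z ω)) atTop (𝓝 (M.expectNext z g))

variable {M : MDP S A} {μ : Measure Ω} {X : ℕ → S × A → Ω → S}

lemma IsSampling.obeysLLN [MeasurableSpace S] [MeasurableSingletonClass S]
    [IsProbabilityMeasure μ] (hX : M.IsSampling μ X) : M.ObeysLLN μ X := by
  intro z g
  have hg : Measurable g := measurable_of_finite g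
  have hmean : ∫ ω, g (X 0 z ω) ∂μ = M.expectNext z g := by
    rw [← integral_map (hX.measurable 0 z).aemeasurable hg.aestronglyMeasurable, hX.law]
    exact M.integral_toMeasure_P z g
  have hproj : Measurable fun f : S × A → S => g (f z) := hg.comp (measurable_pi_apply z)
  rw [← hmean]
  exact strong_law_ae (fun l ω => g (X l z ω))
    (Integrable.comp_measurable .of_finite (hX.measurable 0 z))
    (fun i j hij => (hX.indep.indepFun hij).comp hproj hproj)
    (fun l => IdentDistrib.comp ⟨(hX.measurable l z).aemeasurable,
      (hX.measurable 0 z).aemeasurable, by rw [hX.law, hX.law]⟩ hg)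

lemma ObeysLLN.tendsto_runningAvg_empBellmanQ [Fintype A] [Nonempty A] (hX : M.ObeysLLN μ X)
    (p : S × A → ℝ) : ∀ᵐ ω ∂μ, Tendsto
      (runningAvg fun l => M.empBellmanQ (fun z => X l z ω) p) atTop (𝓝 (M.bellmanQ p)) := by
  filter_upwards [ae_all_iff.2 fun z => hX z fun s' => M.c z + M.γ * minQ p s'] with ω hω
  refine tendsto_pi_nhds.2 fun z => ?_
  rw [bellmanQ_apply, ← expectNext_const_add_mul]
  simp only [runningAvg_apply]
  exact hω z

end Sampling

end MDP

theorem theorem2_general {S A Ω : Type*} [Fintype S] [MeasurableSpace S]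
    [MeasurableSingletonClass S] [Fintype A] [Nonempty A] (M : MDP S A)
    [MeasurableSpace Ω] (μ : Measure Ω) (X : ℕ → S × A → Ω → S) (hX : M.ObeysLLN μ X) :
    ∃ qStar : S × A → ℝ, M.IsOptimalQ qStar ∧ qStar = M.bellmanQ qStar ∧
      (∀ (q₀ : S × A → ℝ) (w q : Ω → ℕ → S × A → ℝ),
        (∀ ω, M.IsRankOneRun (fun k z => X k z ω) q₀ (w ω) (q ω)) →
        ∀ᵐ ω ∂μ, Tendsto (q ω) atTop (𝓝 qStar) ∧
          ∀ ρ : ℕ → ℝ, (∀ k, 0 < ρ k) →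
            (fun k => ∑ l ∈ Finset.range k, ρ l) =O[atTop] (fun k => (k : ℝ) * ρ k) →
            (fun k => ‖M.qlIter (fun k z => X k z ω) q₀ k - qStar‖) =O[atTop] ρ →
            (fun k => ‖q ω k - qStar‖) =O[atTop] ρ) ∧
      (∀ r s : ℝ,
        (∀ q₀ : S × A → ℝ, ∀ᵐ ω ∂μ,
          (fun k => ‖M.qlIter (fun k z => X k z ω) q₀ k - qStar‖) =O[atTop]
            (fun k : ℕ => (k : ℝ) ^ (-r) * Real.log k ^ s)) →
        ∀ (q₀ : S × A → ℝ) (w q : Ω → ℕ → S × A → ℝ),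
          (∀ ω, M.IsRankOneRun (fun k z => X k z ω) q₀ (w ω) (q ω)) →
          ∀ᵐ ω ∂μ, (fun k => ‖q ω k - qStar‖) =O[atTop]
            (fun k : ℕ => (k : ℝ) ^ (-r) * Real.log k ^ s)) := by
  obtain ⟨qStar, hfix⟩ := M.exists_eq_bellmanQ
  refine ⟨qStar, M.isOptimalQ_of_eq_bellmanQ hfix, hfix, fun q₀ w q hrun => ?_,
    fun r s hql q₀ w q hrun => ?_⟩
  · filter_upwards [hX.tendsto_runningAvg_empBellmanQ qStar] with ω hω
    rw [← hfix] at hω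
    exact ⟨(hrun ω).tendsto (M.tendsto_norm_qlIter_sub _ q₀ hω), fun ρ hρ => (hrun ω).isBigO
      (Pi.lt_def.2 ⟨fun k => (hρ k).le, 0, hρ 0⟩)⟩
  · filter_upwards [hql q₀, hql (q₀ + Function.const _ 1)] with ω h₀ h₁
    exact (hrun ω).isBigO_rpow_mul_log_rpow h₀ h₁

theorem theorem2 {S A Ω : Type*} [Fintype S] [MeasurableSpace S] [MeasurableSingletonClass S]
    [Fintype A] [Nonempty A] (M : MDP S A)
    [MeasurableSpace Ω] (μ : Measure Ω) [IsProbabilityMeasure μ]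
    (X : ℕ → S × A → Ω → S) (hX : M.IsSampling μ X) :
    ∃ qStar : S × A → ℝ, M.IsOptimalQ qStar ∧ qStar = M.bellmanQ qStar ∧
      -- almost sure convergence, and comparison of rates along each run
      (∀ q₀ d₀ : S × A → ℝ, d₀ ∈ stdSimplex ℝ (S × A) →
        ∀ (q d : Ω → ℕ → S × A → ℝ) (a : Ω → ℕ → S × A → A),
        (∀ ω, M.IsR1QLRun (fun k z => X k z ω) q₀ d₀ (q ω) (d ω) (a ω)) →
        ∀ᵐ ω ∂μ, Tendsto (q ω) atTop (𝓝 qStar) ∧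
          ∀ ρ : ℕ → ℝ, (∀ k, 0 < ρ k) →
            (fun k => ∑ l ∈ Finset.range k, ρ l) =O[atTop] (fun k => (k : ℝ) * ρ k) →
            (fun k => ‖M.qlIter (fun k z => X k z ω) q₀ k - qStar‖) =O[atTop] ρ →
            (fun k => ‖q ω k - qStar‖) =O[atTop] ρ) ∧
      -- comparison of rates valid for all initializations
      (∀ r s : ℝ,
        (∀ q₀ : S × A → ℝ, ∀ᵐ ω ∂μ,
          (fun k => ‖M.qlIter (fun k z => X k z ω) q₀ k - qStar‖) =O[atTop]
            (fun k : ℕ => (k : ℝ) ^ (-r) * Real.log k ^ s)) →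
        ∀ q₀ d₀ : S × A → ℝ, d₀ ∈ stdSimplex ℝ (S × A) →
          ∀ (q d : Ω → ℕ → S × A → ℝ) (a : Ω → ℕ → S × A → A),
          (∀ ω, M.IsR1QLRun (fun k z => X k z ω) q₀ d₀ (q ω) (d ω) (a ω)) →
          ∀ᵐ ω ∂μ, (fun k => ‖q ω k - qStar‖) =O[atTop]
            (fun k : ℕ => (k : ℝ) ^ (-r) * Real.log k ^ s)) := by
  obtain ⟨qStar, hopt, hfix, hconv, hrate⟩ := theorem2_general M μ X hX.obeysLLN
  exact ⟨qStar, hopt, hfix,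
    fun q₀ d₀ hd₀ q d a hrun => hconv q₀ _ q fun ω => (hrun ω).isRankOneRun hd₀,
    fun r s hql q₀ d₀ hd₀ q d a hrun => hrate r s hql q₀ _ q fun ω => (hrun ω).isRankOneRun hd₀⟩
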